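/- Write $H_n(1)=\sum_{k=1}^{n}\frac1k$ for the harmonic numbers, $B_n$ for the Bernoulli numbers (given by $\frac{t}{e^t-1}=\sum_{n\ge0}B_n\frac{t^n}{n!}$), and, for positive integers $a_1,\dots,a_d$, $$\overline{H}_n(a_1,\dots,a_d)=\sum_{0\le k_1<k_2<\dots<k_d<n}\frac{1}{(2k_1+1)^{a_1}(2k_2+1)^{a_2}\cdots(2k_d+1)^{a_d}}.$$ For rational numbers $a,b$ and a prime $p$, $a\equiv b\pmod{p^m}$ means that $(a-b)/p^m$ is a rational number whose reduced denominator is not divisible by $p$. Then for every prime $p>5$, $$2(-1)^{\frac{p-1}{2}}\sum_{k=0}^{\frac{p-3}{2}}\frac{(-1)^k}{2k+1}\equiv \overline{H}_{\frac{p-1}{2}}(1)-p\,\overline{H}_{\frac{p-1}{2}}(2)-p^2\,\overline{H}_{\frac{p-1}{2}}(2,1)+p^3\,\overline{H}_{\frac{p-1}{2}}(2,2)+p^4\,\overline{H}_{\frac{p-1}{2}}(2,2,1)\pmod{p^5}$$ and $$2(-1)^{\frac{p-1}{2}}\sum_{k=0}^{\frac{p-3}{2}}\frac{(-1)^k}{2k+1}\equiv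 -\frac12\,H_{\frac{p-1}{2}}(1)+\frac{11}{16}\,H_{p-1}(1)-\frac{57}{1280}\,p^4B_{p-5}\pmod{p^5}.$$ -/

import Mathlib

/-- A rational number is `p`-integral if `p` does not divide its reduced denominator. -/
def IsPIntegral (p : ℕ) (x : ℚ) : Prop := ¬ p ∣ x.den

/-- The congruence `a ≡ b (mod p ^ m)` between rational numbers:
`a - b` is `p ^ m` times a `p`-integral rational number. -/
def RatModEq (p m : ℕ) (a b : ℚ) : Prop :=
  ∃ c : ℚ, IsPIntegral p c ∧ a - b = (p : ℚ) ^ m * c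

open Classical in
/-- The multiple harmonic sum with odd denominators: the sum of
`∏ i, 1 / (2 * k i + 1) ^ a i` over all `0 ≤ k 0 < k 1 < ⋯ < k (d - 1) < n`. -/
noncomputable def oddMHS (n : ℕ) {d : ℕ} (a : Fin d → ℕ) : ℚ :=
  ∑ k : Fin d → Fin n with StrictMono k, ∏ i, 1 / (2 * ((k i : ℕ) : ℚ) + 1) ^ a i

/-! Put n = (p-1)/2 and let L be the common left-hand side. The first congruence rests on an exact
identity between rationals: L = ∑_{k<n} (1/(2k+1)) (1 - x/(2k+1)) ∏_{j<k} (1 - x²/(2j+1)²) at x =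
2n+1 = p (`alternating_odd_sum_eq_oddSineSum`). Expanding in powers of x produces the sums with
indices (1), (2), (2,1), (2,2), (2,2,1), and the rest carries x⁵ (`oddSineSum_modEq`).

For the second, take r = φ(p⁵) - 1, so that k^r ≡ 1/k mod p⁵ for k prime to p. Alternating sums of
r-th powers are combinations of two values of the Euler polynomial E_r; expanding these at 0
expresses both L and H_n - H_{2n} through E_r(0), p²E_{r-2}(0) and p⁴E_{r-4}(0). Faulhaber's formula
gives H_{p-1} through the last two, by way of B_{r-1} and B_{r-3}. Eliminating E_r(0) and E_{r-2}(0)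
leaves a multiple of p⁴E_{r-4}(0). It matters only mod p, where Kummer's congruence replaces it by
E_{p-6}(0), hence by B_{p-5}. -/

/-! ### p-integral rationals and congruences modulo p^m -/

namespace IsPIntegral

variable {p : ℕ} {x y : ℚ}

theorem add (hp : p.Prime) (hx : IsPIntegral p x) (hy : IsPIntegral p y) :
    IsPIntegral p (x + y) := fun h =>
  ((hp.dvd_mul).1 (h.trans (Rat.add_den_dvd x y))).elim hx hy

theorem mul (hp : p.Prime) (hx : IsPIntegral p x) (hy : IsPIntegral p y) :
    IsPIntegral p (x * y) := fun h =>
  ((hp.dvd_mul).1 (h.trans (Rat.mul_den_dvd x y))).elim hx hy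

theorem neg (hx : IsPIntegral p x) : IsPIntegral p (-x) := by
  simpa [IsPIntegral] using hx

theorem sub (hp : p.Prime) (hx : IsPIntegral p x) (hy : IsPIntegral p y) :
    IsPIntegral p (x - y) := by
  simpa [sub_eq_add_neg] using hx.add hp hy.neg

theorem intCast (hp : p.Prime) (k : ℤ) : IsPIntegral p (k : ℚ) := by
  simpa [IsPIntegral] using hp.one_lt.ne'

theorem natCast (hp : p.Prime) (k : ℕ) : IsPIntegral p (k : ℚ) := by
  simpa using intCast hp k

theorem ofNat (hp : p.Prime) (k : ℕ) [k.AtLeastTwo] : IsPIntegral p (OfNat.ofNat k : ℚ) :=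
  natCast hp k

theorem zero (hp : p.Prime) : IsPIntegral p 0 := by
  simpa using natCast hp 0

theorem one (hp : p.Prime) : IsPIntegral p 1 := by
  simpa using natCast hp 1

theorem pow (hp : p.Prime) (hx : IsPIntegral p x) (k : ℕ) : IsPIntegral p (x ^ k) := by
  induction k with
  | zero => simpa using one hp
  | succ k ih => simpa [pow_succ] using ih.mul hp hx

theorem sum (hp : p.Prime) {ι : Type*} {s : Finset ι} {f : ι → ℚ}
    (hf : ∀ i ∈ s, IsPIntegral p (f i)) : IsPIntegral p (∑ i ∈ s, f i) :=
  Finset.sum_induction f (IsPIntegral p) (fun _ _ ha hb => ha.add hp hb) (zero hp) hf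

theorem prod (hp : p.Prime) {ι : Type*} {s : Finset ι} {f : ι → ℚ}
    (hf : ∀ i ∈ s, IsPIntegral p (f i)) : IsPIntegral p (∏ i ∈ s, f i) :=
  Finset.prod_induction f (IsPIntegral p) (fun _ _ ha hb => ha.mul hp hb) (one hp) hf

theorem inv_natCast {k : ℕ} (hk : ¬ p ∣ k) : IsPIntegral p (k : ℚ)⁻¹ := by
  have : k ≠ 0 := by rintro rfl; simp at hk
  simpa [IsPIntegral, Rat.inv_natCast_den, this] using hk

theorem inv_natCast_of_lt {k : ℕ} (hk : 0 < k) (hkp : k < p) : IsPIntegral p (k : ℚ)⁻¹ :=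
  inv_natCast fun h => absurd (Nat.le_of_dvd hk h) (not_le.2 hkp)

/-- The inverse of an integer prime to `p` is `p`-integral. -/
theorem inv_intCast {k : ℤ} (hk : ¬ (p : ℤ) ∣ k) : IsPIntegral p (k : ℚ)⁻¹ := by
  have h : ¬ p ∣ k.natAbs := fun h => hk (Int.natCast_dvd.2 h)
  rcases Int.natAbs_eq k with h1 | h1
  · rw [h1, Int.cast_natCast]
    exact inv_natCast h
  · rw [h1, Int.cast_neg, Int.cast_natCast, inv_neg]
    exact (inv_natCast h).neg

/-- `p ^ a / i` is `p`-integral as soon as `p ^ (a + 1)` does not divide `i`. -/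
theorem pow_div_natCast (hp : p.Prime) {a i : ℕ} (hi : ¬ p ^ (a + 1) ∣ i) :
    IsPIntegral p ((p : ℚ) ^ a / i) := by
  have hi0 : i ≠ 0 := by rintro rfl; simp at hi
  obtain ⟨e, k, hk, rfl⟩ := Nat.exists_eq_pow_mul_and_not_dvd hi0 p hp.ne_one
  have he : e ≤ a := by
    by_contra h
    exact hi (Dvd.dvd.mul_right (pow_dvd_pow p (by omega)) k)
  obtain ⟨b, rfl⟩ := Nat.exists_eq_add_of_le he
  have hp0 : (p : ℚ) ≠ 0 := by exact_mod_cast hp.ne_zero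
  have hk0 : (k : ℚ) ≠ 0 := by
    rintro h
    have : k = 0 := by exact_mod_cast h
    simp [this] at hk
  have : (p : ℚ) ^ (e + b) / ((p ^ e * k : ℕ) : ℚ) = (p : ℚ) ^ b * (k : ℚ)⁻¹ := by
    push_cast
    field_simp
    ring
  rw [this]
  exact ((natCast hp p).pow hp b).mul hp (inv_natCast hk)

end IsPIntegral

namespace RatModEq

variable {p m : ℕ} {a b c d : ℚ}

theorem refl (hp : p.Prime) (a : ℚ) : RatModEq p m a a :=
  ⟨0, .zero hp, by ring⟩

theorem of_eq (hp : p.Prime) (h : a = b) : RatModEq p m a b := h ▸ refl hp a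

theorem symm (h : RatModEq p m a b) : RatModEq p m b a := by
  obtain ⟨x, hx, e⟩ := h
  exact ⟨-x, hx.neg, by linear_combination -e⟩

theorem trans (hp : p.Prime) (h : RatModEq p m a b) (h' : RatModEq p m b c) :
    RatModEq p m a c := by
  obtain ⟨x, hx, e⟩ := h
  obtain ⟨y, hy, e'⟩ := h'
  exact ⟨x + y, hx.add hp hy, by linear_combination e + e'⟩

theorem add (hp : p.Prime) (h : RatModEq p m a b) (h' : RatModEq p m c d) :
    RatModEq p m (a + c) (b + d) := by
  obtain ⟨x, hx, e⟩ := h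
  obtain ⟨y, hy, e'⟩ := h'
  exact ⟨x + y, hx.add hp hy, by linear_combination e + e'⟩

theorem mul_left (hp : p.Prime) (hc : IsPIntegral p c) (h : RatModEq p m a b) :
    RatModEq p m (c * a) (c * b) := by
  obtain ⟨x, hx, e⟩ := h
  exact ⟨c * x, hc.mul hp hx, by linear_combination c * e⟩

theorem sum (hp : p.Prime) {ι : Type*} {s : Finset ι} {f g : ι → ℚ}
    (h : ∀ i ∈ s, RatModEq p m (f i) (g i)) :
    RatModEq p m (∑ i ∈ s, f i) (∑ i ∈ s, g i) := by
  classical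
  induction s using Finset.induction_on with
  | empty => simpa using refl hp 0
  | insert i s hi ih =>
    rw [Finset.sum_insert hi, Finset.sum_insert hi]
    exact add hp (h i (by simp)) (ih fun j hj => h j (by simp [hj]))

theorem of_intCast_dvd (hp : p.Prime) {a b : ℤ} (h : ((p : ℤ) ^ m) ∣ a - b) :
    RatModEq p m (a : ℚ) b := by
  obtain ⟨k, hk⟩ := h
  exact ⟨k, .intCast hp k, by exact_mod_cast hk⟩

end RatModEq

/-- Euler's theorem: `k ^ r` inverts `k` modulo `p ^ m` when `r + 1` is a multiple of
`φ (p ^ m)`. -/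
theorem ratModEq_pow_inv {p m r t k : ℕ} (hp : p.Prime) (hr : r + 1 = (p ^ m).totient * t)
    (hk : ¬ p ∣ k) : RatModEq p m ((k : ℚ) ^ r) (k : ℚ)⁻¹ := by
  have hk0 : (k : ℚ) ≠ 0 := by
    rintro h
    have : k = 0 := by exact_mod_cast h
    simp [this] at hk
  have hc : k.Coprime (p ^ m) := ((hp.coprime_iff_not_dvd.2 hk).pow_left m).symm
  have h1 : k ^ (r + 1) ≡ 1 [MOD p ^ m] := by
    rw [hr, pow_mul]
    simpa using (Nat.ModEq.pow_totient hc).pow t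
  have h2 : RatModEq p m (((k ^ (r + 1) : ℕ) : ℤ) : ℚ) ((1 : ℤ) : ℚ) := by
    apply RatModEq.of_intCast_dvd hp
    have := (Nat.modEq_iff_dvd.1 h1.symm)
    exact_mod_cast this
  have h3 := h2.mul_left hp (IsPIntegral.inv_natCast hk)
  push_cast at h3
  rw [mul_one, pow_succ, mul_comm _ (k : ℚ), inv_mul_cancel_left₀ hk0] at h3
  exact h3

/-! ### Euler polynomials -/

/-- The value at `0` of the `m`-th Euler polynomial. -/
noncomputable def eulerZero (m : ℕ) : ℚ :=
  2 * (1 - 2 ^ (m + 1)) * bernoulli (m + 1) / (m + 1)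

/-- The `m`-th Euler polynomial, as a function. -/
noncomputable def eulerPoly (m : ℕ) (x : ℚ) : ℚ :=
  ∑ i ∈ Finset.range (m + 1), (m.choose i : ℚ) * eulerZero (m - i) * x ^ i

open PowerSeries in
/-- The exponential generating function of `eulerZero`. -/
noncomputable def eulerSeries : PowerSeries ℚ :=
  PowerSeries.mk fun m => eulerZero m / (m.factorial : ℚ)

open PowerSeries in
-- The series form of 2t/(e^t+1) = 2(t/(e^t-1) - 2t/(e^{2t}-1)).
theorem X_mul_eulerSeries :
    X * eulerSeries = 2 * (bernoulliPowerSeries ℚ - rescale (2 : ℚ) (bernoulliPowerSeries ℚ)) := by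
  have h2 : (2 : PowerSeries ℚ) = C (2 : ℚ) := (map_ofNat (C (R := ℚ)) 2).symm
  ext n
  rw [h2, coeff_C_mul, map_sub, coeff_rescale]
  cases n with
  | zero => simp [coeff_zero_eq_constantCoeff]
  | succ n =>
    rw [coeff_succ_X_mul, eulerSeries, bernoulliPowerSeries, coeff_mk, coeff_mk, eulerZero,
      Nat.factorial_succ]
    have := Nat.factorial_ne_zero n
    simp only [Algebra.algebraMap_self, RingHom.id_apply]
    push_cast
    field_simp

open PowerSeries in
theorem eulerSeries_mul_exp_add_one : eulerSeries * (exp ℚ + 1) = 2 := by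
  have hB := bernoulliPowerSeries_mul_exp_sub_one ℚ
  have hB2 : rescale (2 : ℚ) (bernoulliPowerSeries ℚ) * (exp ℚ ^ 2 - 1) = 2 * X := by
    have h := congrArg (rescale (2 : ℚ)) hB
    have he := exp_pow_eq_rescale_exp (A := ℚ) 2
    push_cast at he
    rw [map_mul, map_sub, map_one, ← he, rescale_X] at h
    rw [h, map_ofNat]
  have hE := X_mul_eulerSeries
  have hne : (exp ℚ - 1 : PowerSeries ℚ) ≠ 0 := by
    intro h
    rw [h, mul_zero] at hB
    exact X_ne_zero hB.symm
  -- After multiplication by X(e^X - 1), the factor e^{2X} - 1 = (e^X - 1)(e^X + 1) clears both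
  -- Bernoulli series.
  apply mul_left_cancel₀ (mul_ne_zero (X_ne_zero (R := ℚ)) hne)
  linear_combination (exp ℚ - 1) * (exp ℚ + 1) * hE + 2 * (exp ℚ + 1) * hB - 2 * hB2

open PowerSeries in
theorem coeff_eulerSeries_mul_rescale_exp (m : ℕ) (x : ℚ) :
    coeff m (eulerSeries * rescale x (exp ℚ)) = eulerPoly m x / (m.factorial : ℚ) := by
  rw [mul_comm, coeff_mul, Finset.Nat.sum_antidiagonal_eq_sum_range_succ_mk, eulerPoly,
    Finset.sum_div]
  refine Finset.sum_congr rfl fun i hi => ?_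
  have him : i ≤ m := by simpa [Nat.lt_succ_iff] using hi
  have h1 := Nat.factorial_ne_zero i
  have h2 := Nat.factorial_ne_zero (m - i)
  have h3 := Nat.factorial_ne_zero m
  rw [Nat.cast_choose ℚ him]
  simp only [coeff_rescale, coeff_exp, eulerSeries, coeff_mk, Algebra.algebraMap_self,
    RingHom.id_apply]
  field_simp

open PowerSeries in
theorem eulerPoly_add_one (m : ℕ) (x : ℚ) :
    eulerPoly m (x + 1) + eulerPoly m x = 2 * x ^ m := by
  have h1 : rescale (1 : ℚ) (exp ℚ) = exp ℚ := by simp [rescale_one]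
  have h : eulerSeries * rescale (x + 1) (exp ℚ) + eulerSeries * rescale x (exp ℚ) =
      C (2 : ℚ) * rescale x (exp ℚ) := by
    have h2 : (2 : PowerSeries ℚ) = C (2 : ℚ) := (map_ofNat (C (R := ℚ)) 2).symm
    rw [← exp_mul_exp_eq_exp_add, h1, ← h2, ← eulerSeries_mul_exp_add_one]
    ring
  have hm := congrArg (coeff m) h
  rw [map_add, coeff_eulerSeries_mul_rescale_exp, coeff_eulerSeries_mul_rescale_exp, coeff_C_mul,
    coeff_rescale, coeff_exp] at hm
  have h3 := Nat.factorial_ne_zero m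
  simp only [Algebra.algebraMap_self, RingHom.id_apply] at hm
  field_simp at hm
  linear_combination hm

theorem eulerZero_zero : eulerZero 0 = 1 := by
  norm_num [eulerZero]

theorem eulerZero_of_even {m : ℕ} (hm : Even m) (h0 : m ≠ 0) : eulerZero m = 0 := by
  rw [eulerZero, bernoulli_eq_zero_of_odd hm.add_one (by omega)]
  simp

theorem eulerPoly_zero (m : ℕ) : eulerPoly m 0 = eulerZero m := by
  rw [eulerPoly, Finset.sum_range_succ']
  simp

/-- For odd m the coefficients E_{m-i}(0) vanish at odd i < m, so the leading term is the only odd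
one. -/
theorem eulerPoly_neg {m : ℕ} (hm : Odd m) (x : ℚ) :
    eulerPoly m (-x) = eulerPoly m x - 2 * x ^ m := by
  have key : ∀ i ∈ Finset.range m, (m.choose i : ℚ) * eulerZero (m - i) * (-x) ^ i =
      (m.choose i : ℚ) * eulerZero (m - i) * x ^ i := by
    intro i hi
    have him : i < m := by simpa using hi
    rcases Nat.even_or_odd i with h | h
    · rw [h.neg_pow]
    · rw [eulerZero_of_even (Nat.Odd.sub_odd hm h) (by omega)]
      simp
  rw [eulerPoly, eulerPoly, Finset.sum_range_succ, Finset.sum_range_succ,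
    Finset.sum_congr rfl key, hm.neg_pow]
  simp [eulerZero_zero]
  ring

/-- The shift and reflection formulas at ∓1/2 add up to 2E_m(1/2) = 0. This removes the lower
endpoint of the sum over odd denominators. -/
theorem eulerPoly_half {m : ℕ} (hm : Odd m) : eulerPoly m (1 / 2) = 0 := by
  have h1 := eulerPoly_add_one m (-(1 / 2))
  have h2 := eulerPoly_neg hm (1 / 2)
  rw [hm.neg_pow] at h1
  norm_num at h1 h2 ⊢
  linarith

theorem two_mul_alternating_sum (m N : ℕ) (x : ℚ) :
    2 * ∑ k ∈ Finset.range N, (-1 : ℚ) ^ k * (x + k) ^ m =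
      eulerPoly m x - (-1) ^ N * eulerPoly m (x + N) := by
  induction N with
  | zero => simp
  | succ N ih =>
    rw [Finset.sum_range_succ, mul_add, ih]
    have := eulerPoly_add_one m (x + N)
    push_cast
    rw [← add_assoc]
    linear_combination (-(-1 : ℚ) ^ N) * this

/-! ### Integrality of Euler values and Bernoulli numbers -/

/-- The relation E_m(1) + E_m(0) = 2·0^m is a recursion for E_m(0) whose only division is by 2. -/
theorem isPIntegral_eulerZero {p : ℕ} (hp : p.Prime) (hp2 : p ≠ 2) (m : ℕ) :
    IsPIntegral p (eulerZero m) := by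
  induction m using Nat.strong_induction_on with
  | _ m ih =>
    have h2 : IsPIntegral p ((2 : ℕ) : ℚ)⁻¹ :=
      IsPIntegral.inv_natCast fun h => hp2 ((Nat.prime_dvd_prime_iff_eq hp Nat.prime_two).1 h)
    have h := eulerPoly_add_one m 0
    rw [eulerPoly_zero, eulerPoly, Finset.sum_range_succ'] at h
    have : eulerZero m = ((2 : ℕ) : ℚ)⁻¹ * (2 * 0 ^ m - ∑ i ∈ Finset.range m,
        (m.choose (i + 1) : ℚ) * eulerZero (m - (i + 1))) := by
      simp at h ⊢
      linear_combination h / 2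
    rw [this]
    refine h2.mul hp (.sub hp (.mul hp (.ofNat hp 2) ((IsPIntegral.zero hp).pow hp m))
      (.sum hp fun i hi => .mul hp (.natCast hp _) (ih _ ?_)))
    have := Finset.mem_range.1 hi
    omega

theorem isPIntegral_mul_bernoulli {p : ℕ} (hp : p.Prime) (hp2 : p ≠ 2) (m : ℕ) :
    IsPIntegral p (p * bernoulli m) := by
  rcases Nat.even_or_odd' m with ⟨k, rfl | rfl⟩
  · obtain ⟨z, hz⟩ := Bernoulli.vonStaudt_clausen k
    rw [← sub_eq_iff_eq_add] at hz
    rw [← hz, mul_sub, Finset.mul_sum]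
    refine .sub hp (.mul hp (.natCast hp p) (.intCast hp z)) (.sum hp fun q hq => ?_)
    have hq' : q.Prime := (Finset.mem_filter.1 hq).2.1
    by_cases h : p = q
    · subst h
      have : (p : ℚ) ≠ 0 := by exact_mod_cast hp.ne_zero
      rw [mul_one_div_cancel this]
      exact .one hp
    · rw [one_div]
      exact .mul hp (.natCast hp p)
        (.inv_natCast fun h' => h ((Nat.prime_dvd_prime_iff_eq hp hq').1 h'))
  · rcases Nat.eq_zero_or_pos k with rfl | hk
    · have h2 : IsPIntegral p ((2 : ℕ) : ℚ)⁻¹ :=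
        IsPIntegral.inv_natCast fun h => hp2 ((Nat.prime_dvd_prime_iff_eq hp Nat.prime_two).1 h)
      have : (p : ℚ) * bernoulli (2 * 0 + 1) = p * -((2 : ℕ) : ℚ)⁻¹ := by norm_num
      rw [this]
      exact .mul hp (.natCast hp p) h2.neg
    · rw [bernoulli_eq_zero_of_odd ⟨k, rfl⟩ (by omega), mul_zero]
      exact .zero hp

/-! ### Truncated Euler and Faulhaber expansions -/

open Finset

/-- All numerical denominators below involve only 2, 3 and 5; the exponent 8 accommodates 1280 =
2⁸·5. -/
theorem not_dvd_of_dvd_thirty_pow {p k : ℕ} (hp : p.Prime) (hp5 : 5 < p) (hk : k ∣ 30 ^ 8) :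
    ¬ p ∣ k := by
  intro h
  have h30 : p ∣ 2 * 3 * 5 := hp.dvd_of_dvd_pow (h.trans hk)
  rcases (hp.dvd_mul).1 h30 with h' | h'
  · rcases (hp.dvd_mul).1 h' with h'' | h''
    · have := Nat.le_of_dvd (by norm_num) h''; omega
    · have := Nat.le_of_dvd (by norm_num) h''; omega
  · have := Nat.le_of_dvd (by norm_num) h'; omega

theorem IsPIntegral.div_ofNat {p : ℕ} {x : ℚ} (hp : p.Prime) (hp5 : 5 < p)
    (hx : IsPIntegral p x) (k : ℕ) [k.AtLeastTwo] (hk : k ∣ 30 ^ 8) :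
    IsPIntegral p (x / OfNat.ofNat k) := by
  rw [div_eq_mul_inv]
  exact hx.mul hp (.inv_natCast (not_dvd_of_dvd_thirty_pow hp hp5 hk))

theorem eulerPoly_modEq_one {p : ℕ} (hp : p.Prime) (hp2 : p ≠ 2) (m : ℕ) {y : ℚ}
    (hy : IsPIntegral p y) : RatModEq p 1 (eulerPoly m (p * y)) (eulerZero m) := by
  refine ⟨∑ i ∈ range m, (m.choose (i + 1) : ℚ) * eulerZero (m - (i + 1)) * (p ^ i * y ^ (i + 1)),
    .sum hp fun i _ => .mul hp (.mul hp (.natCast hp _) (isPIntegral_eulerZero hp hp2 _))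
      (.mul hp ((IsPIntegral.natCast hp p).pow hp _) (hy.pow hp _)), ?_⟩
  rw [eulerPoly, sum_range_succ', mul_sum]
  simp only [Nat.choose_zero_right, Nat.cast_one, Nat.sub_zero, pow_zero, mul_one, one_mul,
    add_sub_cancel_right]
  refine sum_congr rfl fun i _ => ?_
  ring

theorem eulerPoly_modEq_five {p r : ℕ} (hp : p.Prime) (hp2 : p ≠ 2) (hr : Odd r) (hr5 : 5 ≤ r)
    {y : ℚ} (hy : IsPIntegral p y) :
    RatModEq p 5 (eulerPoly r (p * y))
      (eulerZero r + r.choose 2 * eulerZero (r - 2) * (p * y) ^ 2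
        + r.choose 4 * eulerZero (r - 4) * (p * y) ^ 4) := by
  refine ⟨∑ i ∈ range (r - 4), (r.choose (5 + i) : ℚ) * eulerZero (r - (5 + i)) *
      (p ^ i * y ^ (5 + i)),
    .sum hp fun i _ => .mul hp (.mul hp (.natCast hp _) (isPIntegral_eulerZero hp hp2 _))
      (.mul hp ((IsPIntegral.natCast hp p).pow hp _) (hy.pow hp _)), ?_⟩
  have h1 : eulerZero (r - 1) = 0 := eulerZero_of_even (Nat.Odd.sub_odd hr (by decide)) (by omega)
  have h3 : eulerZero (r - 3) = 0 := eulerZero_of_even (Nat.Odd.sub_odd hr (by decide)) (by omega)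
  have key : ∀ i, (r.choose (5 + i) : ℚ) * eulerZero (r - (5 + i)) * (p * y) ^ (5 + i) =
      p ^ 5 * ((r.choose (5 + i) : ℚ) * eulerZero (r - (5 + i)) * (p ^ i * y ^ (5 + i))) := by
    intro i
    ring
  rw [eulerPoly, show r + 1 = 5 + (r - 4) by omega, sum_range_add, sum_congr rfl fun i _ => key i,
    ← mul_sum]
  simp [sum_range_succ, h1, h3]

/-- Faulhaber's formula for `∑ k < p, k ^ r`, truncated modulo `p ^ 5`. -/
theorem sum_pow_modEq_five {p r : ℕ} (hp : p.Prime) (hp5 : 5 < p) (hr : Odd r) (hr7 : 7 ≤ r) :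
    RatModEq p 5 (∑ k ∈ range p, (k : ℚ) ^ r)
      (p ^ 2 * (r * bernoulli (r - 1) / 2) +
        p ^ 4 * (r.choose 3 * bernoulli (r - 3) / 4)) := by
  have key : ∑ k ∈ range p, (k : ℚ) ^ r =
      ∑ j ∈ range (r + 1), (r.choose j : ℚ) * bernoulli (r - j) * p ^ (j + 1) / (j + 1) := by
    rw [sum_range_pow, ← sum_range_reflect]
    refine sum_congr rfl fun j hj => ?_
    have hj' : j ≤ r := by simpa [Nat.lt_succ_iff] using hj
    have e1 : r + 1 - 1 - j = r - j := by omega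
    have e2 : r + 1 - (r - j) = j + 1 := by omega
    have e3 : (r + 1).choose (r - j) = (r + 1).choose (j + 1) := by
      rw [← Nat.choose_symm (by omega : j + 1 ≤ r + 1)]
      congr 1
      omega
    have e4 : ((r : ℚ) + 1) * r.choose j = (r + 1).choose (j + 1) * (j + 1) := by
      exact_mod_cast Nat.add_one_mul_choose_eq r j
    rw [e1, e2, e3]
    have : (r : ℚ) + 1 ≠ 0 := by positivity
    have : (j : ℚ) + 1 ≠ 0 := by positivity
    field_simp
    linear_combination -bernoulli (r - j) * e4
  have b0 : bernoulli r = 0 := bernoulli_eq_zero_of_odd hr (by omega)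
  have b2 : bernoulli (r - 2) = 0 :=
    bernoulli_eq_zero_of_odd (Nat.Odd.sub_even (by omega) hr (by decide)) (by omega)
  have b4 : bernoulli (r - 4) = 0 :=
    bernoulli_eq_zero_of_odd (Nat.Odd.sub_even (by omega) hr (by decide)) (by omega)
  -- Beyond p⁵, one factor p makes the Bernoulli number integral, and p^i absorbs the denominator i
  -- + 6 because i + 6 < 7^(i+1) ≤ p^(i+1).
  refine ⟨∑ i ∈ range (r - 4), (r.choose (5 + i) : ℚ) * (p * bernoulli (r - (5 + i))) *
      (p ^ i / (i + 6 : ℕ)),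
    .sum hp fun i _ => .mul hp (.mul hp (.natCast hp _) (isPIntegral_mul_bernoulli hp (by omega) _))
      (.pow_div_natCast hp fun h => ?_), ?_⟩
  · have h1 := Nat.le_of_dvd (by omega) h
    have h2 : 7 ^ (i + 1) ≤ p ^ (i + 1) := Nat.pow_le_pow_left
      (by
        rcases Nat.lt_or_ge p 7 with h | h
        · have : p = 6 := by omega
          subst this
          norm_num at hp
        · exact h) _
    have h3 : i < 7 ^ i := Nat.lt_pow_self (by norm_num)
    rw [pow_succ] at h2
    omega
  · have tail : ∀ i, (r.choose (5 + i) : ℚ) * bernoulli (r - (5 + i)) * p ^ (5 + i + 1) /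
        ((5 + i : ℕ) + 1) =
        p ^ 5 * ((r.choose (5 + i) : ℚ) * (p * bernoulli (r - (5 + i))) *
          (p ^ i / (i + 6 : ℕ))) := by
      intro i
      have : ((5 + i : ℕ) : ℚ) + 1 = (i + 6 : ℕ) := by push_cast; ring
      rw [this]
      ring
    rw [key, show r + 1 = 5 + (r - 4) by omega, sum_range_add, sum_congr rfl fun i _ => tail i,
      ← mul_sum]
    simp [sum_range_succ, b0, b2, b4]
    ring

theorem harmonic_sub_harmonic_two_mul (n : ℕ) :
    harmonic n - harmonic (2 * n) =
      ∑ k ∈ range (2 * n), (-1 : ℚ) ^ (k + 1) * ((k + 1 : ℕ) : ℚ)⁻¹ := by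
  induction n with
  | zero => simp
  | succ n ih =>
    rw [show 2 * (n + 1) = 2 * n + 1 + 1 by ring, sum_range_succ, sum_range_succ, ← ih,
      harmonic_succ, harmonic_succ, harmonic_succ]
    have h1 : (n : ℚ) + 1 ≠ 0 := by positivity
    simp only [pow_succ, pow_mul]
    push_cast
    have h2 : (2 * (n : ℚ) + 1 + 1) = 2 * (n + 1) := by ring
    rw [h2, mul_inv]
    ring

/-- Recover a Bernoulli number modulo `p ^ a` from the corresponding Euler value, when
the index is `-l` and the power of two is `2⁻ʲ` modulo `p ^ a`. -/
theorem bernoulli_modEq_eulerZero {p a s : ℕ} (hp : p.Prime) (hp5 : 5 < p) (ha : a ≠ 0)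
    {j : ℕ} {l c d : ℤ} (hj : ¬ (p : ℤ) ∣ 2 ^ j - 1)
    (h2 : (2 : ℤ) ^ j * 2 ^ (s + 1) = 1 + p ^ a * c) (hs : ((s + 1 : ℕ) : ℤ) = -l + p ^ a * d) :
    RatModEq p a (bernoulli (s + 1)) (-(l * 2 ^ j / (2 * (2 ^ j - 1))) * eulerZero s) := by
  have hv : ¬ (p : ℤ) ∣ 1 - 2 ^ (s + 1) := by
    intro h
    apply hj
    have h3 : (2 : ℤ) ^ j - 1 = 2 ^ j * (1 - 2 ^ (s + 1)) + p ^ a * c := by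
      linear_combination h2
    rw [h3]
    exact dvd_add (h.mul_left _) (Dvd.dvd.mul_right (dvd_pow_self _ ha) _)
  have hv0 : ((1 : ℚ) - 2 ^ (s + 1)) ≠ 0 := by
    intro h
    apply hv
    have : ((1 : ℤ) - 2 ^ (s + 1)) = 0 := by exact_mod_cast h
    simp [this]
  have hj0 : ((2 : ℚ) ^ j - 1) ≠ 0 := by
    intro h
    apply hj
    have : ((2 : ℤ) ^ j - 1) = 0 := by exact_mod_cast h
    simp [this]
  have i1 := IsPIntegral.inv_intCast hv
  have i2 := IsPIntegral.inv_intCast hj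
  have i3 : IsPIntegral p (((d * (2 ^ j - 1) - l * c : ℤ) : ℚ) / 2) :=
    .div_ofNat hp hp5 (.intCast hp _) 2 (by norm_num)
  refine ⟨_, ((i1.mul hp i2).mul hp i3).mul hp (isPIntegral_eulerZero hp (by omega) s), ?_⟩
  have h2' : (2 : ℚ) ^ j * 2 ^ (s + 1) = 1 + p ^ a * c := by exact_mod_cast h2
  have hs' : ((s : ℚ) + 1) = -l + p ^ a * d := by exact_mod_cast hs
  have hs0 : (s : ℚ) + 1 ≠ 0 := by positivity
  -- Replacing s+1 by -l and 2^(s+1) by 2^(-j) in this formula gives the stated constant.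
  have hB : bernoulli (s + 1) = ((s : ℚ) + 1) * eulerZero s / (2 * (1 - 2 ^ (s + 1))) := by
    rw [eulerZero]
    field_simp
  rw [hB, hs']
  push_cast
  field_simp
  linear_combination (-eulerZero s * l) * h2'

theorem cast_choose_two_three_four {r : ℕ} (hr : 4 ≤ r) :
    (r.choose 2 : ℚ) * 2 = r * (r - 1) ∧ (r.choose 3 : ℚ) * 6 = r * (r - 1) * (r - 2) ∧
      (r.choose 4 : ℚ) * 24 = r * (r - 1) * (r - 2) * (r - 3) := by
  have step : ∀ k ≤ r, (r.choose (k + 1) : ℚ) * (k + 1) = r.choose k * (r - k) := by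
    intro k hk
    have := Nat.choose_succ_right_eq r k
    rw [← Nat.cast_sub hk]
    exact_mod_cast this
  have h1 := step 1 (by omega)
  have h2 := step 2 (by omega)
  have h3 := step 3 (by omega)
  norm_num at h1 h2 h3
  refine ⟨h1, ?_, ?_⟩
  · linear_combination 2 * h2 + (r - 2) * h1
  · linear_combination 6 * h3 + 2 * (r - 3 : ℚ) * h2 + (r - 2) * (r - 3 : ℚ) * h1

theorem alternating_sum_pow_modEq_one {p m : ℕ} (hp : p.Prime) (hp2 : p ≠ 2) :
    RatModEq p 1 (∑ k ∈ range p, (-1 : ℚ) ^ k * (k : ℚ) ^ m) (eulerZero m) := by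
  have h := two_mul_alternating_sum m p 0
  rw [(hp.odd_of_ne_two hp2).neg_one_pow, eulerPoly_zero, zero_add] at h
  simp only [zero_add] at h
  have h1 := eulerPoly_modEq_one hp hp2 m (.one hp)
  rw [mul_one] at h1
  obtain ⟨c, hc, e⟩ := h1
  have h2 : IsPIntegral p ((2 : ℕ) : ℚ)⁻¹ :=
    IsPIntegral.inv_natCast fun h => hp2 ((Nat.prime_dvd_prime_iff_eq hp Nat.prime_two).1 h)
  refine ⟨((2 : ℕ) : ℚ)⁻¹ * c, h2.mul hp hc, ?_⟩
  push_cast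
  linear_combination h / 2 + e / 2

/-- Kummer's congruence for Euler values. -/
theorem eulerZero_modEq_of_sub_one {p m : ℕ} (hp : p.Prime) (hp2 : p ≠ 2) (hm : m ≠ 0) (s : ℕ) :
    RatModEq p 1 (eulerZero (m + (p - 1) * s)) (eulerZero m) := by
  refine ((alternating_sum_pow_modEq_one hp hp2).symm.trans hp
    (.sum hp fun k _ => .mul_left hp ?_ ?_)).trans hp (alternating_sum_pow_modEq_one hp hp2)
  · exact (IsPIntegral.one hp).neg.pow hp k
  · have h : (p : ℤ) ^ 1 ∣ (k : ℤ) ^ (m + (p - 1) * s) - (k : ℤ) ^ m := by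
      rw [pow_one, pow_add, pow_mul, ← mul_sub_one]
      -- When p ∣ k, both powers vanish mod p because m ≠ 0; otherwise Fermat applies.
      by_cases hk : p ∣ k
      · exact ((Int.natCast_dvd_natCast.2 hk).trans (dvd_pow_self _ hm)).mul_right _
      · have h1 : (k : ℤ) ^ (p - 1) ≡ 1 [ZMOD p] :=
          Int.ModEq.pow_card_sub_one_eq_one hp
            (Nat.isCoprime_iff_coprime.2 ((hp.coprime_iff_not_dvd.2 hk).symm))
        have h2 := (h1.pow s).symm.dvd
        rw [one_pow] at h2
        exact h2.mul_left _
    exact_mod_cast RatModEq.of_intCast_dvd hp h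

/-! ### Harmonic sums as sums of r-th powers, r = p⁴(p-1) - 1 -/

section Exponent

variable {p r : ℕ}

theorem IsPIntegral.pow_four_mul_sub_one (hp : p.Prime) :
    IsPIntegral p ((p : ℚ) ^ 4 * (p - 1)) :=
  .mul hp ((IsPIntegral.natCast hp p).pow hp 4) (.sub hp (.natCast hp p) (.one hp))

/-- Since r ≡ -1 mod p⁴, C(r,j) behaves like C(-1,j) = (-1)^j. The witness is the exact quotient,
and likewise for j = 3, 4. -/
theorem choose_two_modEq (hp : p.Prime) (hp5 : 5 < p) (hr4 : 4 ≤ r)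
    (hr : (r : ℚ) = p ^ 4 * (p - 1) - 1) : RatModEq p 4 (r.choose 2 : ℚ) 1 := by
  have h := (cast_choose_two_three_four hr4).1
  refine ⟨(p - 1) * (p ^ 4 * (p - 1) - 3) / 2, .div_ofNat hp hp5 (.mul hp
    (.sub hp (.natCast hp p) (.one hp)) (.sub hp (.pow_four_mul_sub_one hp) (.ofNat hp 3)))
    2 (by norm_num), ?_⟩
  rw [hr] at h
  linear_combination h / 2

theorem choose_three_modEq (hp : p.Prime) (hp5 : 5 < p) (hr4 : 4 ≤ r)
    (hr : (r : ℚ) = p ^ 4 * (p - 1) - 1) : RatModEq p 4 (r.choose 3 : ℚ) (-1) := by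
  have h := (cast_choose_two_three_four hr4).2.1
  have hε := IsPIntegral.pow_four_mul_sub_one hp
  refine ⟨(p - 1) * (p ^ 4 * (p - 1) * (p ^ 4 * (p - 1) - 6) + 11) / 6, .div_ofNat hp hp5 (.mul hp
    (.sub hp (.natCast hp p) (.one hp)) (.add hp (.mul hp hε (.sub hp hε (.ofNat hp 6)))
    (.ofNat hp 11))) 6 (by norm_num), ?_⟩
  rw [hr] at h
  linear_combination h / 6

theorem choose_four_modEq (hp : p.Prime) (hp5 : 5 < p) (hr4 : 4 ≤ r)
    (hr : (r : ℚ) = p ^ 4 * (p - 1) - 1) : RatModEq p 4 (r.choose 4 : ℚ) 1 := by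
  have h := (cast_choose_two_three_four hr4).2.2
  have hε := IsPIntegral.pow_four_mul_sub_one hp
  refine ⟨(p - 1) * (p ^ 4 * (p - 1) * (p ^ 4 * (p - 1) * (p ^ 4 * (p - 1) - 10) + 35) - 50) / 24,
    .div_ofNat hp hp5 (.mul hp (.sub hp (.natCast hp p) (.one hp)) (.sub hp
    (.mul hp hε (.add hp (.mul hp hε (.sub hp hε (.ofNat hp 10))) (.ofNat hp 35)))
    (.ofNat hp 50))) 24 (by norm_num), ?_⟩
  rw [hr] at h
  linear_combination h / 24

theorem eulerPoly_mul_modEq (hp : p.Prime) (hp5 : 5 < p) (hodd : Odd r) (hr5 : 5 ≤ r)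
    (hr : (r : ℚ) = p ^ 4 * (p - 1) - 1) {y : ℚ} (hy : IsPIntegral p y) :
    RatModEq p 5 (eulerPoly r (p * y))
      (eulerZero r + eulerZero (r - 2) * y ^ 2 * p ^ 2 + eulerZero (r - 4) * y ^ 4 * p ^ 4) := by
  obtain ⟨c, hc, e⟩ := eulerPoly_modEq_five hp (by omega) hodd hr5 hy
  obtain ⟨c2, hc2, e2⟩ := choose_two_modEq hp hp5 (by omega) hr
  obtain ⟨c4, hc4, e4⟩ := choose_four_modEq hp hp5 (by omega) hr
  have hP := IsPIntegral.natCast hp p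
  refine ⟨c + (c2 * eulerZero (r - 2) * y ^ 2 * p + c4 * eulerZero (r - 4) * y ^ 4 * p ^ 3),
    .add hp hc (.add hp ?_ ?_), ?_⟩
  · exact .mul hp (.mul hp (.mul hp hc2 (isPIntegral_eulerZero hp (by omega) _)) (hy.pow hp 2)) hP
  · exact .mul hp (.mul hp (.mul hp hc4 (isPIntegral_eulerZero hp (by omega) _)) (hy.pow hp 4))
      (hP.pow hp 3)
  · linear_combination e + eulerZero (r - 2) * (p * y) ^ 2 * e2 +
      eulerZero (r - 4) * (p * y) ^ 4 * e4

theorem harmonic_prime_sub_one_modEq (hp : p.Prime) (hp5 : 5 < p) (hodd : Odd r) (hr7 : 7 ≤ r)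
    (hr : r + 1 = p ^ 4 * (p - 1)) :
    RatModEq p 5 (harmonic (p - 1))
      (2 / 3 * eulerZero (r - 2) * p ^ 2 + 8 / 15 * eulerZero (r - 4) * p ^ 4) := by
  have hrZ : (r : ℤ) = p ^ 4 * (p - 1) - 1 := by
    have : ((r + 1 : ℕ) : ℤ) = p ^ 4 * (p - 1) := by
      rw [hr]; push_cast [hp.one_le]; ring
    push_cast at this
    linarith
  have hrQ : (r : ℚ) = p ^ 4 * (p - 1) - 1 := by exact_mod_cast hrZ
  have htot : r + 1 = (p ^ 5).totient * 1 := by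
    rw [hr, Nat.totient_prime_pow hp (by norm_num)]; simp
  have hpi : ∀ k ∈ range (p - 1), IsPIntegral p (((k + 1 : ℕ) : ℚ)⁻¹) := fun k hk =>
    .inv_natCast_of_lt (by omega) (by have := mem_range.1 hk; omega)
  have hH : RatModEq p 5 (∑ k ∈ range p, (k : ℚ) ^ r) (harmonic (p - 1)) := by
    have : range p = range (p - 1 + 1) := by congr 1; omega
    rw [this, sum_range_succ']
    simp only [Nat.cast_zero, zero_pow (by omega : r ≠ 0), add_zero, harmonic]
    exact .sum hp fun k hk => ratModEq_pow_inv hp htot fun h =>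
      absurd (Nat.le_of_dvd (by omega) h) (by have := mem_range.1 hk; omega)
  obtain ⟨c, hc⟩ : ∃ c : ℤ, (2 : ℤ) ^ (r + 1) = 1 + p ^ 5 * c := by
    have hcop : Nat.Coprime 2 (p ^ 5) :=
      ((Nat.coprime_primes Nat.prime_two hp).2 (by omega)).pow_right 5
    have h1 := (Nat.ModEq.pow_totient hcop).symm
    obtain ⟨c, hc⟩ := Nat.modEq_iff_dvd.1 h1
    rw [mul_one] at htot
    refine ⟨c, ?_⟩
    rw [htot]
    push_cast at hc
    linarith
  -- Here r-1 ≡ -2 and 2^(r-1) ≡ 2^(-2), giving the factor -4/3; below, r-3 ≡ -4 and 2^(r-3) ≡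
  -- 2^(-4) give -32/15. Multiplied by r/2 ≡ -1/2 and C(r,3)/4 ≡ -1/4, these become 2/3 and 8/15.
  obtain ⟨c1, i1, e1⟩ := bernoulli_modEq_eulerZero (a := 4) (s := r - 2) (j := 2) (l := 2)
    (c := p * c) (d := p - 1) hp hp5 (by norm_num)
    (by
      intro h
      exact not_dvd_of_dvd_thirty_pow (k := 3) hp hp5 (by norm_num) (by norm_num at h; exact_mod_cast h))
    (by
      rw [← pow_add, show 2 + (r - 2 + 1) = r + 1 by omega, hc]; ring)
    (by
      rw [show r - 2 + 1 = r - 1 by omega]; push_cast [show 1 ≤ r by omega]; rw [hrZ]; ring)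
  obtain ⟨c3, i3, e3⟩ := bernoulli_modEq_eulerZero (a := 4) (s := r - 4) (j := 4) (l := 4)
    (c := p * c) (d := p - 1) hp hp5 (by norm_num)
    (by
      intro h
      exact not_dvd_of_dvd_thirty_pow (k := 15) hp hp5 (by norm_num) (by norm_num at h; exact_mod_cast h))
    (by
      rw [← pow_add, show 4 + (r - 4 + 1) = r + 1 by omega, hc]; ring)
    (by
      rw [show r - 4 + 1 = r - 3 by omega]; push_cast [show 3 ≤ r by omega]; rw [hrZ]; ring)
  rw [show r - 2 + 1 = r - 1 by omega] at e1
  rw [show r - 4 + 1 = r - 3 by omega] at e3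
  obtain ⟨cC, iC, eC⟩ := choose_three_modEq hp hp5 (by omega) hrQ
  obtain ⟨cF, iF, eF⟩ := hH.symm.trans hp (sum_pow_modEq_five hp hp5 hodd hr7)
  have hP := IsPIntegral.natCast hp p
  have hE := isPIntegral_eulerZero hp (by omega : p ≠ 2)
  refine ⟨cF + p * (r * c1 / 2) - (p - 1) * (2 * eulerZero (r - 2) / 3) * p
      + p ^ 3 * (r.choose 3 * c3 / 4) - cC * (8 * eulerZero (r - 4) / 15) * p ^ 3,
    .sub hp (.add hp (.sub hp (.add hp iF ?_) ?_) ?_) ?_, ?_⟩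
  · exact .mul hp hP (.div_ofNat hp hp5 (.mul hp (.natCast hp r) i1) 2 (by norm_num))
  · exact .mul hp (.mul hp (.sub hp hP (.one hp))
      (.div_ofNat hp hp5 (.mul hp (.ofNat hp 2) (hE _)) 3 (by norm_num))) hP
  · exact .mul hp (hP.pow hp 3)
      (.div_ofNat hp hp5 (.mul hp (.natCast hp _) i3) 4 (by norm_num))
  · exact .mul hp (.mul hp iC
      (.div_ofNat hp hp5 (.mul hp (.ofNat hp 8) (hE _)) 15 (by norm_num))) (hP.pow hp 3)
  · norm_num at e1 e3
    linear_combination eF + p ^ 2 * r / 2 * e1 + p ^ 4 * r.choose 3 / 4 * e3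
      - p ^ 2 * (2 * eulerZero (r - 2) / 3) * hrQ - p ^ 4 * (8 * eulerZero (r - 4) / 15) * eC

end Exponent

theorem harmonic_half_sub_modEq {p n r : ℕ} (hp : p.Prime) (hp5 : 5 < p) (hn : p = 2 * n + 1)
    (hodd : Odd r) (hr7 : 7 ≤ r) (hr : r + 1 = p ^ 4 * (p - 1)) :
    RatModEq p 5 (harmonic n - harmonic (2 * n))
      (eulerZero r + eulerZero (r - 2) / 2 * p ^ 2 + eulerZero (r - 4) / 2 * p ^ 4) := by
  have hrQ : (r : ℚ) = p ^ 4 * (p - 1) - 1 := by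
    have : ((r + 1 : ℕ) : ℚ) = p ^ 4 * (p - 1) := by
      rw [hr]; push_cast [hp.one_le]; ring
    push_cast at this
    linarith
  have htot : r + 1 = (p ^ 5).totient * 1 := by
    rw [hr, Nat.totient_prime_pow hp (by norm_num)]; simp
  have hA : RatModEq p 5 (∑ k ∈ range p, (-1 : ℚ) ^ k * (k : ℚ) ^ r)
      (harmonic n - harmonic (2 * n)) := by
    rw [harmonic_sub_harmonic_two_mul, hn, sum_range_succ']
    simp only [Nat.cast_zero, zero_pow (by omega : r ≠ 0), mul_zero, add_zero]
    rw [← hn]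
    exact .sum hp fun k hk => .mul_left hp ((IsPIntegral.one hp).neg.pow hp _)
      (ratModEq_pow_inv hp htot fun h =>
        absurd (Nat.le_of_dvd (by omega) h) (by have := mem_range.1 hk; omega))
  have h := two_mul_alternating_sum r p 0
  rw [(hp.odd_of_ne_two (by omega)).neg_one_pow, eulerPoly_zero, zero_add] at h
  simp only [zero_add] at h
  have h1 := eulerPoly_mul_modEq hp hp5 hodd (by omega) hrQ (.one hp)
  rw [mul_one] at h1
  obtain ⟨c, hc, e⟩ := h1
  obtain ⟨d, hd, e'⟩ := hA
  refine ⟨c / 2 - d, .sub hp (.div_ofNat hp hp5 hc 2 (by norm_num)) hd, ?_⟩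
  linear_combination h / 2 + e / 2 - e'

/-- Writing 2k+1 = 2(1/2 + k) makes this an alternating sum from 1/2 to p/2. As E_r(1/2) = 0, only
-2^r E_r(p/2) remains, with 2^r ≡ 1/2. -/
theorem alternating_odd_sum_modEq {p n r : ℕ} (hp : p.Prime) (hp5 : 5 < p) (hn : p = 2 * n + 1)
    (hodd : Odd r) (hr7 : 7 ≤ r) (hr : r + 1 = p ^ 4 * (p - 1)) :
    RatModEq p 5 (2 * (-1 : ℚ) ^ n * ∑ k ∈ range n, (-1 : ℚ) ^ k / (2 * (k : ℚ) + 1))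
      (-(eulerZero r / 2 + eulerZero (r - 2) / 8 * p ^ 2 + eulerZero (r - 4) / 32 * p ^ 4)) := by
  have hrQ : (r : ℚ) = p ^ 4 * (p - 1) - 1 := by
    have : ((r + 1 : ℕ) : ℚ) = p ^ 4 * (p - 1) := by
      rw [hr]; push_cast [hp.one_le]; ring
    push_cast at this
    linarith
  have htot : r + 1 = (p ^ 5).totient * 1 := by
    rw [hr, Nat.totient_prime_pow hp (by norm_num)]; simp
  have hS : RatModEq p 5 (∑ k ∈ range n, (-1 : ℚ) ^ k * (((2 * k + 1 : ℕ) : ℚ)) ^ r)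
      (∑ k ∈ range n, (-1 : ℚ) ^ k / (2 * (k : ℚ) + 1)) := by
    refine .sum hp fun k hk => ?_
    rw [div_eq_mul_inv]
    refine .mul_left hp ((IsPIntegral.one hp).neg.pow hp _) ?_
    have := ratModEq_pow_inv (k := 2 * k + 1) hp htot fun h =>
        absurd (Nat.le_of_dvd (by omega) h) (by have := mem_range.1 hk; omega)
    push_cast at this ⊢
    exact this
  have hS' : ∑ k ∈ range n, (-1 : ℚ) ^ k * (((2 * k + 1 : ℕ) : ℚ)) ^ r =
      2 ^ r * ∑ k ∈ range n, (-1 : ℚ) ^ k * (1 / 2 + k) ^ r := by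
    rw [mul_sum]
    refine sum_congr rfl fun k _ => ?_
    have : ((2 * k + 1 : ℕ) : ℚ) = 2 * (1 / 2 + k) := by push_cast; ring
    rw [this, mul_pow]
    ring
  have hhalf : (1 / 2 + n : ℚ) = p * (1 / 2) := by rw [hn]; push_cast; ring
  have h := two_mul_alternating_sum r n (1 / 2)
  rw [eulerPoly_half hodd, hhalf] at h
  have i2 : IsPIntegral p (1 / 2) := .div_ofNat hp hp5 (.one hp) 2 (by norm_num)
  obtain ⟨c, hc, e⟩ := eulerPoly_mul_modEq hp hp5 hodd (by omega) hrQ i2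
  obtain ⟨d, hd, e'⟩ := hS
  obtain ⟨f, hf, e2⟩ := ratModEq_pow_inv (k := 2) hp htot
    (not_dvd_of_dvd_thirty_pow hp hp5 (by norm_num))
  have hsq : (-1 : ℚ) ^ n * (-1) ^ n = 1 := by rw [← mul_pow]; norm_num
  have hE := isPIntegral_eulerZero hp (by omega : p ≠ 2)
  have hP := IsPIntegral.natCast hp p
  have hval : IsPIntegral p (eulerZero r + eulerZero (r - 2) * (1 / 2) ^ 2 * p ^ 2
      + eulerZero (r - 4) * (1 / 2) ^ 4 * p ^ 4) :=
    .add hp (.add hp (hE _) (.mul hp (.mul hp (hE _) (i2.pow hp 2)) (hP.pow hp 2)))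
      (.mul hp (.mul hp (hE _) (i2.pow hp 4)) (hP.pow hp 4))
  refine ⟨-(2 * (-1) ^ n * d) - 2 ^ r * c - f * (eulerZero r + eulerZero (r - 2) * (1 / 2) ^ 2 * p ^ 2
      + eulerZero (r - 4) * (1 / 2) ^ 4 * p ^ 4), .sub hp (.sub hp (IsPIntegral.neg ?_) ?_) ?_, ?_⟩
  · exact .mul hp (.mul hp (.ofNat hp 2) ((IsPIntegral.one hp).neg.pow hp n)) hd
  · exact .mul hp ((IsPIntegral.ofNat hp 2).pow hp r) hc
  · exact .mul hp hf hval
  · rw [hS'] at e'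
    push_cast at e2
    linear_combination (-2) * (-1) ^ n * e' + 2 ^ r * (-1) ^ n * h - 2 ^ r * e
      - 2 ^ r * eulerPoly r (p * (1 / 2)) * hsq -
      (eulerZero r + eulerZero (r - 2) * (1 / 2) ^ 2 * p ^ 2
        + eulerZero (r - 4) * (1 / 2) ^ 4 * p ^ 4) * e2

theorem bernoulli_prime_sub_five_modEq {p : ℕ} (hp : p.Prime) (hp5 : 5 < p) :
    RatModEq p 1 (bernoulli (p - 5)) (-(8 / 3) * eulerZero (p - 6)) := by
  obtain ⟨c, hc⟩ : ∃ c : ℤ, (2 : ℤ) ^ (p - 1) = 1 + p * c := by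
    have h1 : (2 : ℤ) ^ (p - 1) ≡ 1 [ZMOD p] :=
      Int.ModEq.pow_card_sub_one_eq_one hp (by
        have := (Nat.coprime_primes Nat.prime_two hp).2 (by omega)
        exact_mod_cast Nat.isCoprime_iff_coprime.2 this)
    obtain ⟨c, hc⟩ := h1.symm.dvd
    exact ⟨c, by linarith⟩
  have h := bernoulli_modEq_eulerZero (a := 1) (s := p - 6) (j := 4) (l := 5)
    (c := c) (d := 1) hp hp5 (by norm_num)
    (by
      intro h
      exact not_dvd_of_dvd_thirty_pow (k := 15) hp hp5 (by norm_num) (by norm_num at h; exact_mod_cast h))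
    (by
      rw [← pow_add, show 4 + (p - 6 + 1) = p - 1 by omega, hc]; ring)
    (by
      rw [show p - 6 + 1 = p - 5 by omega]; push_cast [show 5 ≤ p by omega]; ring)
  rw [show p - 6 + 1 = p - 5 by omega] at h
  norm_num at h ⊢
  exact h

theorem alternating_odd_sum_modEq_harmonic {p n : ℕ} (hp : p.Prime) (hp5 : 5 < p)
    (hn : p = 2 * n + 1) :
    RatModEq p 5 (2 * (-1 : ℚ) ^ n * ∑ k ∈ range n, (-1 : ℚ) ^ k / (2 * (k : ℚ) + 1))
      (-(1 / 2) * harmonic n + 11 / 16 * harmonic (2 * n)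
        - 57 / 1280 * (p : ℚ) ^ 4 * bernoulli (p - 5)) := by
  obtain ⟨r, hr⟩ : ∃ r, r + 1 = p ^ 4 * (p - 1) :=
    ⟨p ^ 4 * (p - 1) - 1, Nat.sub_add_cancel
      (Nat.mul_pos (pow_pos hp.pos 4) (Nat.sub_pos_of_lt hp.one_lt))⟩
  have hodd : Odd r := by
    have : Even (r + 1) := by
      rw [hr, hn]
      exact Even.mul_left (by simp) _
    rwa [Nat.even_add_one, Nat.not_even_iff_odd] at this
  -- The decomposition of r - 4 is the shape required by Kummer's congruence.
  have hbig : 7 ≤ r ∧ r - 4 = p - 6 + (p - 1) * (p ^ 4 - 1) := by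
    have h4 : 6 ^ 4 ≤ p ^ 4 := Nat.pow_le_pow_left hp5 4
    have h5 : 5 * (6 ^ 4 - 1) ≤ (p - 1) * (p ^ 4 - 1) := Nat.mul_le_mul (by omega) (by omega)
    have h6 : p ^ 4 * (p - 1) = (p - 1) * (p ^ 4 - 1) + (p - 1) := by
      obtain ⟨q, hq⟩ := Nat.exists_eq_add_of_le (show 1 ≤ p ^ 4 by omega)
      rw [hq, Nat.add_sub_cancel_left]
      ring
    omega
  obtain ⟨hr7, hr4⟩ := hbig
  have hp6 : p ≠ 6 := by
    rintro rfl
    norm_num at hp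
  obtain ⟨cL, iL, eL⟩ := alternating_odd_sum_modEq hp hp5 hn hodd hr7 hr
  obtain ⟨cA, iA, eA⟩ := harmonic_half_sub_modEq hp hp5 hn hodd hr7 hr
  obtain ⟨cH, iH, eH⟩ := harmonic_prime_sub_one_modEq hp hp5 hodd hr7 hr
  obtain ⟨cB, iB, eB⟩ := bernoulli_prime_sub_five_modEq hp hp5
  obtain ⟨cK, iK, eK⟩ := eulerZero_modEq_of_sub_one hp (by omega)
    (by omega : p - 6 ≠ 0) (p ^ 4 - 1)
  rw [← hr4] at eK
  rw [show p - 1 = 2 * n by omega] at eH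
  -- Adding half of H_n - H_{2n} cancels E_r(0) and leaves p²E_{r-2}(0)/8 + 7p⁴E_{r-4}(0)/32.
  -- Subtracting 3/16 of H_{p-1} cancels the p² term and leaves 7/32 - 1/10 = 19/160; then 19/160 ·
  -- 3/8 = 57/1280.
  refine ⟨cL + cA / 2 - 3 * cH / 16 + 19 * cK / 160 + 57 * cB / 1280,
    .add hp (.add hp (.sub hp (.add hp iL ?_) ?_) ?_) ?_, ?_⟩
  · exact .div_ofNat hp hp5 iA 2 (by norm_num)
  · exact .div_ofNat hp hp5 (.mul hp (.ofNat hp 3) iH) 16 (by norm_num)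
  · exact .div_ofNat hp hp5 (.mul hp (.ofNat hp 19) iK) 160 (by norm_num)
  · exact .div_ofNat hp hp5 (.mul hp (.ofNat hp 57) iB) 1280 (by norm_num)
  · linear_combination eL + eA / 2 - 3 / 16 * eH + 19 / 160 * p ^ 4 * eK + 57 / 1280 * p ^ 4 * eB

/-! ### Recursion for multiple harmonic sums -/

theorem Fin.strictMono_iff_init_last {d : ℕ} {k : Fin (d + 1) → ℕ} :
    StrictMono k ↔ StrictMono (Fin.init k) ∧ ∀ i, Fin.init k i < k (Fin.last d) := by
  constructor
  · intro h
    exact ⟨fun i j hij => h (Fin.castSucc_lt_castSucc_iff.2 hij), fun i => h (Fin.castSucc_lt_last i)⟩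
  · rintro ⟨h1, h2⟩ i j hij
    induction j using Fin.lastCases with
    | last =>
      induction i using Fin.lastCases with
      | last => exact absurd hij (lt_irrefl _)
      | cast i => exact h2 i
    | cast j =>
      induction i using Fin.lastCases with
      | last => exact absurd hij (not_lt.2 (Fin.le_last _))
      | cast i => exact h1 (Fin.castSucc_lt_castSucc_iff.1 hij)

open Classical in
-- Indices in ℕ instead of `Fin n` let the upper bound vary when the largest index is split off.
theorem oddMHS_eq_sum_piFinset (n : ℕ) {d : ℕ} (a : Fin d → ℕ) :
    oddMHS n a = ∑ k ∈ Fintype.piFinset (fun _ : Fin d => range n) with StrictMono k,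
      ∏ i, 1 / (2 * (k i : ℚ) + 1) ^ a i := by
  refine sum_nbij (fun k i => (k i : ℕ)) ?_ ?_ ?_ fun _ _ => rfl
  · intro k hk
    simp only [mem_filter, mem_univ, true_and, Fintype.mem_piFinset, mem_range] at hk ⊢
    exact ⟨fun i => (k i).2, fun i j hij => hk hij⟩
  · intro k _ k' _ h
    funext i
    exact Fin.ext (congrFun h i)
  · intro k hk
    simp only [coe_filter, Fintype.mem_piFinset, mem_range, Set.mem_ofPred_eq] at hk
    refine ⟨fun i => ⟨k i, hk.1 i⟩, ?_, rfl⟩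
    simp only [coe_filter, mem_univ, true_and, Set.mem_ofPred_eq]
    exact fun i j hij => hk.2 hij

theorem oddMHS_eq_sum_range (n : ℕ) {d : ℕ} (a : Fin (d + 1) → ℕ) :
    oddMHS n a = ∑ m ∈ range n, oddMHS m (Fin.init a) * (1 / (2 * (m : ℚ) + 1)) ^ a (Fin.last d) := by
  classical
  simp only [oddMHS_eq_sum_piFinset, sum_mul]
  rw [sum_sigma']
  refine sum_nbij' (fun k => ⟨k (Fin.last d), Fin.init k⟩)
    (fun x => Fin.snoc (α := fun _ => ℕ) x.2 x.1) ?_ ?_ ?_ ?_ ?_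
  · intro k hk
    simp only [mem_filter, Fintype.mem_piFinset, mem_range, mem_sigma,
      Fin.strictMono_iff_init_last (k := k)] at hk ⊢
    exact ⟨hk.1 _, hk.2.2, hk.2.1⟩
  · rintro ⟨m, k⟩ hk
    simp only [mem_filter, Fintype.mem_piFinset, mem_range, mem_sigma] at hk ⊢
    refine ⟨fun i => ?_, Fin.strictMono_iff_init_last.2 ⟨?_, fun i => ?_⟩⟩
    · induction i using Fin.lastCases with
      | last => simpa using hk.1
      | cast i => simpa using (hk.2.1 i).trans hk.1
    · simpa using hk.2.2
    · simpa using hk.2.1 i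
  · intro k _
    exact Fin.snoc_init_self k
  · rintro ⟨m, k⟩ _
    simp
  · intro k _
    rw [Fin.prod_univ_castSucc]
    simp [Fin.init]

theorem oddMHS_zero (n : ℕ) (a : Fin 0 → ℕ) : oddMHS n a = 1 := by
  rw [oddMHS_eq_sum_piFinset, filter_true_of_mem fun k _ => Subsingleton.strictMono k]
  simp

theorem oddMHS_zero_left {d : ℕ} (a : Fin (d + 1) → ℕ) : oddMHS 0 a = 0 := by
  simp [oddMHS_eq_sum_range]

theorem oddMHS_succ (n : ℕ) {d : ℕ} (a : Fin (d + 1) → ℕ) :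
    oddMHS (n + 1) a = oddMHS n a +
      oddMHS n (Fin.init a) * (1 / (2 * (n : ℚ) + 1)) ^ a (Fin.last d) := by
  rw [oddMHS_eq_sum_range (n + 1), sum_range_succ, ← oddMHS_eq_sum_range]

theorem isPIntegral_one_div_odd {p k : ℕ} (hk : 2 * k + 1 < p) :
    IsPIntegral p (1 / (2 * (k : ℚ) + 1)) := by
  have := IsPIntegral.inv_natCast_of_lt (p := p) (k := 2 * k + 1) (by omega) hk
  rw [one_div]
  exact_mod_cast this

theorem isPIntegral_oddMHS {p : ℕ} (hp : p.Prime) {n d : ℕ} (a : Fin d → ℕ) (hn : 2 * n ≤ p) :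
    IsPIntegral p (oddMHS n a) := by
  refine .sum hp fun k _ => .prod hp fun i _ => ?_
  rw [← one_div_pow]
  refine (isPIntegral_one_div_odd ?_).pow hp _
  have := (k i).2
  have := hp.eq_two_or_odd
  omega

/-! ### The generating sum and the exact identity -/

/-- The product `∏ j < k, (1 - x ^ 2 / (2 * j + 1) ^ 2)`. -/
def oddSineProduct (x : ℚ) (k : ℕ) : ℚ :=
  ∏ j ∈ range k, (1 - (x * (1 / (2 * (j : ℚ) + 1))) ^ 2)

/-- The generating sum whose expansion in `x` has coefficients given by `oddMHS`. -/
def oddSineSum (x : ℚ) (n : ℕ) : ℚ :=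
  ∑ k ∈ range n, 1 / (2 * (k : ℚ) + 1) * (1 - x * (1 / (2 * (k : ℚ) + 1))) * oddSineProduct x k

/-- Product and sum share one induction, since each new term of the sum contains the product. -/
theorem oddSineSum_modEq {p n : ℕ} (hp : p.Prime) (hn : 2 * n ≤ p) :
    RatModEq p 5 (oddSineProduct p n)
      (1 - (p : ℚ) ^ 2 * oddMHS n ![2] + (p : ℚ) ^ 4 * oddMHS n ![2, 2]) ∧
    RatModEq p 5 (oddSineSum p n)
      (oddMHS n ![1] - (p : ℚ) * oddMHS n ![2] - (p : ℚ) ^ 2 * oddMHS n ![2, 1]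
        + (p : ℚ) ^ 3 * oddMHS n ![2, 2] + (p : ℚ) ^ 4 * oddMHS n ![2, 2, 1]) := by
  induction n with
  | zero =>
    simp only [oddMHS_zero_left]
    exact ⟨.of_eq hp (by simp [oddSineProduct]), .of_eq hp (by simp [oddSineSum])⟩
  | succ n ih =>
    obtain ⟨⟨c, hc, e⟩, ⟨d, hd, e'⟩⟩ := ih (by omega)
    have hq : IsPIntegral p (1 / (2 * (n : ℚ) + 1)) := isPIntegral_one_div_odd (by
      have := hp.eq_two_or_odd
      omega)
    have i22 := isPIntegral_oddMHS hp ![2, 2] (show 2 * n ≤ p by omega)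
    have hP := IsPIntegral.natCast hp p
    have s1 := oddMHS_succ n ![1]
    have s2 := oddMHS_succ n ![2]
    have s21 := oddMHS_succ n ![2, 1]
    have s22 := oddMHS_succ n ![2, 2]
    have s221 := oddMHS_succ n ![2, 2, 1]
    have t2 : ∀ a b : ℕ, Fin.init ![a, b] = ![a] := fun a b => by
      funext i; fin_cases i; rfl
    have t3 : Fin.init ![2, 2, 1] = ![2, 2] := by
      funext i; fin_cases i <;> rfl
    rw [oddMHS_zero] at s1 s2
    rw [t2] at s21 s22
    rw [t3] at s221
    have l1 : ∀ a : ℕ, ![a] (Fin.last 0) = a := fun _ => rfl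
    have l2 : ∀ a b : ℕ, ![a, b] (Fin.last 1) = b := fun _ _ => rfl
    have l3 : ∀ a b c : ℕ, ![a, b, c] (Fin.last 2) = c := fun _ _ _ => rfl
    rw [l1] at s1 s2
    rw [l2] at s21 s22
    rw [l3] at s221
    rw [oddSineProduct, prod_range_succ, ← oddSineProduct, oddSineSum, sum_range_succ,
      ← oddSineSum, s1, s2, s21, s22, s221]
    generalize 1 / (2 * (n : ℚ) + 1) = q at *
    have h1 : IsPIntegral p (1 - p * q) := .sub hp (.one hp) (hP.mul hp hq)
    have h2 : IsPIntegral p (1 - (p * q) ^ 2) := .sub hp (.one hp) ((hP.mul hp hq).pow hp 2)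
    -- The newly dropped terms are -p⁶q²H(2,2) in the product and -p⁵q²H(2,2) in the sum.
    refine ⟨⟨c * (1 - (p * q) ^ 2) - p * (q ^ 2 * oddMHS n ![2, 2]), .sub hp (hc.mul hp h2)
      (.mul hp hP (.mul hp (hq.pow hp 2) i22)), ?_⟩,
      ⟨d + q * (1 - p * q) * c - q ^ 2 * oddMHS n ![2, 2], .sub hp (hd.add hp
      (.mul hp (hq.mul hp h1) hc)) (.mul hp (hq.pow hp 2) i22), ?_⟩⟩
    · linear_combination (1 - (p * q) ^ 2) * e
    · linear_combination e' + q * (1 - p * q) * e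

theorem oddSineProduct_succ (x : ℚ) (k : ℕ) :
    oddSineProduct x (k + 1) = oddSineProduct x k * (1 - (x * (1 / (2 * (k : ℚ) + 1))) ^ 2) :=
  prod_range_succ _ _

/-- Factoring (2j+1)² - x² at x = 2n+1 and x = 2n+3 gives 4(j-n)(j+n+1) and 4(j-n-1)(j+n+2), so the
ratio of the products telescopes. -/
theorem oddSineProduct_add_two (n k : ℕ) :
    oddSineProduct (2 * n + 3) k * (n + 1 - k) = oddSineProduct (2 * n + 1) k * (n + 1 + k) := by
  induction k with
  | zero => simp [oddSineProduct]
  | succ k ih =>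
    rw [oddSineProduct_succ, oddSineProduct_succ]
    have : 2 * (k : ℚ) + 1 ≠ 0 := by positivity
    push_cast
    field_simp
    linear_combination (-4) * (n - k : ℚ) * (n + k + 2) * ih

/-- With P_k the product and x = 2n+1, each term x²P_k/(2k+1)² equals P_k - P_{k+1}. -/
theorem sum_oddSineProduct_div_sq (n K : ℕ) :
    (2 * (n : ℚ) + 1) ^ 2 * ∑ k ∈ range K, oddSineProduct (2 * n + 1) k / (2 * (k : ℚ) + 1) ^ 2 =
      1 - oddSineProduct (2 * n + 1) K := by
  induction K with
  | zero => simp [oddSineProduct]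
  | succ K ih =>
    rw [sum_range_succ, mul_add, ih, oddSineProduct_succ, mul_one_div, div_pow]
    ring

/-- Over (2k+1)², the two summands have numerators -2(n+1+k)P_k and -2(n-k)P_k, where P_k is the
product at 2n+1. They add up to -2(2n+1)P_k, and the telescoping sum ends at P_{n+1} = 0. -/
theorem oddSineSum_succ_add (n : ℕ) :
    oddSineSum (2 * n + 3) (n + 1) + oddSineSum (2 * n + 1) n = -2 / (2 * n + 1) := by
  have hn : 2 * (n : ℚ) + 1 ≠ 0 := by positivity
  -- The extra term k = n vanishes because 1 - x/(2n+1) = 0 at x = 2n+1.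
  have h0 : oddSineSum (2 * n + 1) n = oddSineSum (2 * n + 1) (n + 1) := by
    rw [oddSineSum, oddSineSum, sum_range_succ, mul_one_div_cancel hn]
    simp
  have h1 : oddSineSum (2 * n + 3) (n + 1) + oddSineSum (2 * n + 1) (n + 1) =
      -2 * (2 * n + 1) *
        ∑ k ∈ range (n + 1), oddSineProduct (2 * n + 1) k / (2 * (k : ℚ) + 1) ^ 2 := by
    rw [oddSineSum, oddSineSum, ← sum_add_distrib, mul_sum]
    refine sum_congr rfl fun k _ => ?_
    have hk := oddSineProduct_add_two n k
    have : 2 * (k : ℚ) + 1 ≠ 0 := by positivity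
    field_simp
    linear_combination (-2) * hk
  have h2 := sum_oddSineProduct_div_sq n (n + 1)
  rw [oddSineProduct_succ, mul_one_div_cancel hn] at h2
  rw [h0, h1, eq_div_iff hn]
  linear_combination (-2) * h2

theorem alternating_odd_sum_eq_oddSineSum (n : ℕ) :
    2 * (-1 : ℚ) ^ n * ∑ k ∈ range n, (-1 : ℚ) ^ k / (2 * (k : ℚ) + 1) =
      oddSineSum (2 * n + 1) n := by
  induction n with
  | zero => simp [oddSineSum]
  | succ n ih =>
    have h := oddSineSum_succ_add n
    have hsq : (-1 : ℚ) ^ n * (-1) ^ n = 1 := by rw [← mul_pow]; norm_num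
    have e : (2 * ((n + 1 : ℕ) : ℚ) + 1) = 2 * n + 3 := by push_cast; ring
    rw [e, sum_range_succ, pow_succ]
    linear_combination (-1) * ih - h - 2 / (2 * n + 1) * hsq

theorem theorem2p4 (p : ℕ) (hp : p.Prime) (hp5 : 5 < p) :
    RatModEq p 5
      (2 * (-1 : ℚ) ^ ((p - 1) / 2) *
        ∑ k ∈ Finset.range ((p - 3) / 2 + 1), (-1 : ℚ) ^ k / (2 * (k : ℚ) + 1))
      (oddMHS ((p - 1) / 2) ![1]
        - (p : ℚ) * oddMHS ((p - 1) / 2) ![2]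
        - (p : ℚ) ^ 2 * oddMHS ((p - 1) / 2) ![2, 1]
        + (p : ℚ) ^ 3 * oddMHS ((p - 1) / 2) ![2, 2]
        + (p : ℚ) ^ 4 * oddMHS ((p - 1) / 2) ![2, 2, 1]) ∧
    RatModEq p 5
      (2 * (-1 : ℚ) ^ ((p - 1) / 2) *
        ∑ k ∈ Finset.range ((p - 3) / 2 + 1), (-1 : ℚ) ^ k / (2 * (k : ℚ) + 1))
      (-(1 / 2) * harmonic ((p - 1) / 2) + 11 / 16 * harmonic (p - 1)
        - 57 / 1280 * (p : ℚ) ^ 4 * bernoulli (p - 5)) := by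
  obtain ⟨n, hn⟩ := hp.odd_of_ne_two (by omega)
  have h1 : (p - 1) / 2 = n := by omega
  have h2 : (p - 3) / 2 + 1 = n := by omega
  have h3 : p - 1 = 2 * n := by omega
  rw [h1, h2, h3]
  refine ⟨?_, alternating_odd_sum_modEq_harmonic hp hp5 hn⟩
  have hpn : (2 * (n : ℚ) + 1) = p := by rw [hn]; push_cast; ring
  rw [alternating_odd_sum_eq_oddSineSum, hpn]
  exact (oddSineSum_modEq hp (by omega)).2
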